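/- Let $N\ge 3$ and let $|\psi\rangle\in(\mathbb C^2)^{\otimes N}$ be a normalized $N$-qubit pure state. Equality of state vectors is understood up to a global phase factor. The state $|\psi\rangle$ is called entangled if it is not a product $|e_1,\dots,e_N\rangle=\bigotimes_i|e_i\rangle$ of normalized single-qubit states. A mixed state of several qubits is called separable if it is a finite convex combination of projectors onto such product states of these qubits. An entangled state $|\psi\rangle$ is called fragile with respect to the loss of qubit $k$ if its reduced state $\mathrm{Tr}_k(|\psi\rangle\langle\psi|)$ on the remaining $N-1$ qubits is separable. Let $\mathcal A$ be a nonempty subset of the $N$ qubits. Then $|\psi\rangle$ is entangled and fragile with respect to the loss of every qubit $k\in\mathcal A$ if and only if it can be written in the form $$|\psi\rangle=\sqrt p\,|e_1,\dots,e_N\rangle+\sqrt{1-p}\,|e_1',\dots,e_N'\rangle ,$$ where $0<p<1$ and $|e_i\rangle,|e_i'\rangle$ ($i=1,\dots,N$) are normalized single-qubit states with $|e_i'\rangle\perp|e_i\rangle$ for all $i\in\mathcal A$ and, if $\#\mathcal A=1$, $|e_j'\rangle\ne|e_j\rangle$ (as states, i.e. up to a phase factor) for at least one qubit $j\notin\mathcal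 A$. -/

import Mathlib

namespace QubitFragility

/-- The state space `ℂ²` of one qubit. -/
abbrev Qubit : Type := EuclideanSpace ℂ (Fin 2)

/-- The state space `(ℂ²)^{⊗ι}` of a system of qubits labelled by `ι`, in the computational basis
`|x⟩`, `x : ι → {0, 1}`. -/
abbrev Qubits (ι : Type) : Type := EuclideanSpace ℂ (ι → Fin 2)

/-- Equality of state vectors up to a global phase factor. -/
def SameState {κ : Type} (ψ φ : EuclideanSpace ℂ κ) : Prop :=
  ∃ c : ℂ, ‖c‖ = 1 ∧ ψ = c • φ

/-- The product vector `⊗ᵢ |eᵢ⟩`. -/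
noncomputable def productVec {ι : Type} [Fintype ι] (e : ι → Qubit) : Qubits ι :=
  WithLp.toLp 2 fun x => ∏ i, e i (x i)

/-- A (pure) state is entangled if it is not a product of normalized single-qubit states. -/
def IsEntangled {ι : Type} [Fintype ι] (ψ : Qubits ι) : Prop :=
  ¬ ∃ e : ι → Qubit, (∀ i, ‖e i‖ = 1) ∧ SameState ψ (productVec e)

/-- The operator `|ψ⟩⟨ψ|`, as a matrix in the computational basis. -/
def ketBra {κ : Type} (ψ : EuclideanSpace ℂ κ) : Matrix κ κ ℂ :=
  Matrix.of fun x y => ψ x * star (ψ y)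

/-- The basis label that is `a` at qubit `k` and `x` on the other qubits. -/
def insertBit {ι : Type} [DecidableEq ι] (k : ι) (a : Fin 2) (x : {i : ι // i ≠ k} → Fin 2) :
    ι → Fin 2 :=
  fun i => if h : i = k then a else x ⟨i, h⟩

/-- The partial trace over qubit `k`, an operator on the remaining qubits. -/
def partialTrace {ι : Type} [DecidableEq ι] (k : ι) (ρ : Matrix (ι → Fin 2) (ι → Fin 2) ℂ) :
    Matrix ({i : ι // i ≠ k} → Fin 2) ({i : ι // i ≠ k} → Fin 2) ℂ :=
  Matrix.of fun x y => ∑ a : Fin 2, ρ (insertBit k a x) (insertBit k a y)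

/-- A mixed state is (fully) separable if it is a finite convex combination of projectors onto
product states of normalized single-qubit states. -/
def IsSeparable {ι : Type} [Fintype ι] (ρ : Matrix (ι → Fin 2) (ι → Fin 2) ℂ) : Prop :=
  ∃ (m : ℕ) (w : Fin m → ℝ) (e : Fin m → ι → Qubit),
    (∀ j, 0 ≤ w j) ∧ ∑ j, w j = 1 ∧ (∀ j i, ‖e j i‖ = 1) ∧
      ρ = ∑ j, (w j : ℂ) • ketBra (productVec (e j))

/-- `ψ` is entangled and fragile with respect to the loss of qubit `k`: the reduced state of the
remaining qubits is separable. -/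
def IsFragile {ι : Type} [Fintype ι] [DecidableEq ι] (k : ι) (ψ : Qubits ι) : Prop :=
  IsEntangled ψ ∧ IsSeparable (partialTrace k (ketBra ψ))

end QubitFragility

namespace QubitFragility

set_option linter.unusedSectionVars false

variable {ι : Type} [Fintype ι] [DecidableEq ι]

/-! Tracing out qubit `k` leaves the sum of the projectors onto the two slices `⟨a|_k ψ`. Hence the
product vectors carrying weight in a separable decomposition span the same space as the slices
(`mem_span_of_sum_ketBra_eq`). Entanglement excludes dimension one, so `ψ = α ⊗ f + β ⊗ g` with `f`,
`g` independent product vectors (`exists_slice_eq`).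

If `f` and `g` differ at two sites, their span contains no other product directions
(`mul_eq_zero_of_productVec_eq`). The reduced state then has no cross terms between `f` and `g`,
which forces `α ⊥ β` (`inner_eq_zero_of_isSeparable`). If they differ at one site only, a two-qubit
Schmidt decomposition produces orthogonal factors both there and at `k`.

The form obtained from one `k ∈ A` serves for all of `A`: at another `l ∈ A` the factors are already
orthogonal, or some third site `j` distinguishes the two terms. In the latter case `j` and `k` are
two differing sites that survive the loss of `l`, and the cross-term argument applies again.

Conversely, orthogonality at the lost qubit removes the cross terms, and two differing sites make
the superposition entangled. -/

/-- The determinant of the two columns `u`, `v`; it vanishes iff they are linearly dependent. -/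
noncomputable def wedge (u v : Qubit) : ℂ := u 0 * v 1 - u 1 * v 0

/-- The bilinear pairing of two qubit vectors. -/
noncomputable def pairing (a u : Qubit) : ℂ := a 0 * u 0 + a 1 * u 1

/-! ### Product vectors and linear dependence of qubit vectors -/

theorem productVec_apply (e : ι → Qubit) (x : ι → Fin 2) :
    productVec e x = ∏ i, e i (x i) := rfl

theorem sum_productVec_mul (g e : ι → Qubit) :
    ∑ x, productVec g x * productVec e x = ∏ i, pairing (g i) (e i) := by
  have h := Finset.prod_univ_sum (fun _ : ι => (Finset.univ : Finset (Fin 2)))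
    (fun i b => g i b * e i b)
  simp only [Fin.sum_univ_two, Fintype.piFinset_univ] at h
  simp only [pairing, h, productVec_apply, Finset.prod_mul_distrib]

theorem inner_productVec (e f : ι → Qubit) :
    inner ℂ (productVec e) (productVec f) = ∏ i, inner ℂ (e i) (f i) := by
  have h := Finset.prod_univ_sum (fun _ : ι => (Finset.univ : Finset (Fin 2)))
    (fun i b => inner ℂ (e i b) (f i b))
  simp only [Fintype.piFinset_univ] at h
  simp only [PiLp.inner_apply, h, productVec_apply]
  refine Finset.sum_congr rfl fun x _ => ?_
  simp [Finset.prod_mul_distrib, map_prod]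

theorem norm_productVec (e : ι → Qubit) : ‖productVec e‖ = ∏ i, ‖e i‖ := by
  have h := inner_productVec e e
  simp only [inner_self_eq_norm_sq_to_K] at h
  have h2 : ‖productVec e‖ ^ 2 = (∏ i, ‖e i‖) ^ 2 := by
    rw [← Finset.prod_pow]
    exact_mod_cast h
  exact (pow_left_inj₀ (norm_nonneg _) (Finset.prod_nonneg fun _ _ => norm_nonneg _)
    two_ne_zero).1 h2

theorem productVec_smul (c : ι → ℂ) (e : ι → Qubit) :
    productVec (fun i => c i • e i) = (∏ i, c i) • productVec e := by
  ext x
  simp [productVec_apply, Finset.prod_mul_distrib]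

theorem qubit_ext {u v : Qubit} (h0 : u 0 = v 0) (h1 : u 1 = v 1) : u = v := by
  ext i; fin_cases i <;> assumption

theorem exists_smul_of_wedge_eq_zero {u v : Qubit} (hu : u ≠ 0) (h : wedge u v = 0) :
    ∃ c : ℂ, v = c • u := by
  unfold wedge at h
  by_cases h0 : u 0 = 0
  · have h1 : u 1 ≠ 0 := fun h1 => hu (qubit_ext (by simpa using h0) (by simpa using h1))
    refine ⟨v 1 / u 1, qubit_ext ?_ ?_⟩
    · rw [h0] at h
      simpa [h1, h0] using h
    · simp [h1]
  · refine ⟨v 0 / u 0, qubit_ext ?_ ?_⟩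
    · simp [h0]
    · simp only [PiLp.smul_apply, smul_eq_mul]
      field_simp
      linear_combination h

theorem wedge_ne_zero_of_inner_eq_zero {u v : Qubit} (hu : u ≠ 0) (hv : v ≠ 0)
    (h : inner ℂ u v = 0) : wedge u v ≠ 0 := by
  intro hw
  obtain ⟨c, rfl⟩ := exists_smul_of_wedge_eq_zero hu hw
  rw [inner_smul_right] at h
  rcases mul_eq_zero.1 h with h | h
  · exact hv (by simp [h])
  · exact hu (inner_self_eq_zero.1 h)

theorem sameState_of_wedge_eq_zero {u v : Qubit} (hu : ‖u‖ = 1) (hv : ‖v‖ = 1)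
    (h : wedge u v = 0) : SameState v u := by
  obtain ⟨c, rfl⟩ := exists_smul_of_wedge_eq_zero (by rintro rfl; simp at hu) h
  exact ⟨c, by simpa [norm_smul, hu] using hv, rfl⟩

theorem wedge_ne_zero_of_not_sameState {u v : Qubit} (hu : ‖u‖ = 1) (hv : ‖v‖ = 1)
    (h : ¬ SameState v u) : wedge u v ≠ 0 :=
  fun hw => h (sameState_of_wedge_eq_zero hu hv hw)

/-- Two nonzero linear forms on `ℂ²` cannot cover it by their kernels. This gives functionals that
contract a site of two product vectors without killing either. -/
theorem exists_pairing_ne_zero {u v : Qubit} (hu : u ≠ 0) (hv : v ≠ 0) :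
    ∃ c : Qubit, pairing c u ≠ 0 ∧ pairing c v ≠ 0 := by
  have key : ∀ {w : Qubit}, w ≠ 0 → w 0 = 0 → w 1 ≠ 0 := fun hw h0 h1 =>
    hw (qubit_ext (by simpa using h0) (by simpa using h1))
  have hu' := key hu
  have hv' := key hv
  by_cases a : u 0 = 0
  · by_cases b : v 1 = 0
    · refine ⟨!₂[1, 1], ?_⟩
      have : v 0 ≠ 0 := fun h => hv' h b
      simpa [pairing, a, b, this] using hu' a
    · refine ⟨!₂[0, 1], ?_⟩
      simpa [pairing, a, b] using hu' a
  · by_cases b : v 0 = 0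
    · by_cases d : u 1 = 0
      · refine ⟨!₂[1, 1], ?_⟩
        simpa [pairing, a, b, d] using hv' b
      · refine ⟨!₂[0, 1], ?_⟩
        simpa [pairing, a, b, d] using hv' b
    · refine ⟨!₂[1, 0], ?_⟩
      simp [pairing, a, b]

/-! ### Product vectors in the span of two product vectors -/

/-- The only product vectors in the span of two product vectors that differ at two or more sites
are the multiples of these two vectors. -/
theorem mul_eq_zero_of_productVec_eq {f u v : ι → Qubit} {α β : ℂ}
    (h : productVec f = α • productVec u + β • productVec v)
    (hu : ∀ i, u i ≠ 0) (hv : ∀ i, v i ≠ 0) {i j : ι} (hij : i ≠ j)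
    (hi : wedge (u i) (v i) ≠ 0) (hj : wedge (u j) (v j) ≠ 0) : α * β = 0 := by
  -- Contracting every site except `i` and `j` with `c` reduces the claim to two qubits, with
  -- nonzero scalars `R u` and `R v` left over.
  choose c hcu hcv using fun l => exists_pairing_ne_zero (hu l) (hv l)
  let S : Finset ι := (Finset.univ.erase j).erase i
  let R : (ι → Qubit) → ℂ := fun e => ∏ l ∈ S, pairing (c l) (e l)
  have hc : ∀ (a b : Qubit) (e : ι → Qubit),
      ∑ x, productVec (Function.update (Function.update c i a) j b) x * productVec e x =
        pairing b (e j) * (pairing a (e i) * R e) := by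
    intro a b e
    rw [sum_productVec_mul, ← Finset.mul_prod_erase _ _ (Finset.mem_univ j),
      ← Finset.mul_prod_erase (Finset.univ.erase j) _ (Finset.mem_erase.2 ⟨hij, Finset.mem_univ i⟩)]
    congr 1
    · simp
    congr 1
    · simp [hij]
    refine Finset.prod_congr rfl fun l hl => ?_
    have hli : l ≠ i := (Finset.mem_erase.1 hl).1
    have hlj : l ≠ j := (Finset.mem_erase.1 (Finset.mem_erase.1 hl).2).1
    simp [hli, hlj]
  have hF : ∀ a b : Qubit, pairing b (f j) * (pairing a (f i) * R f) =
      α * (pairing b (u j) * (pairing a (u i) * R u)) +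
        β * (pairing b (v j) * (pairing a (v i) * R v)) := by
    intro a b
    rw [← hc, ← hc, ← hc, h, Finset.mul_sum, Finset.mul_sum, ← Finset.sum_add_distrib]
    refine Finset.sum_congr rfl fun x _ => ?_
    simp only [PiLp.add_apply, PiLp.smul_apply, smul_eq_mul]
    ring
  have hRu : R u ≠ 0 := Finset.prod_ne_zero_iff.2 fun l _ => hcu l
  have hRv : R v ≠ 0 := Finset.prod_ne_zero_iff.2 fun l _ => hcv l
  let ann : Qubit → Qubit := fun w => !₂[w 1, -w 0]
  have ann_self : ∀ w, pairing (ann w) w = 0 := fun w => by simp [ann, pairing]; ring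
  have ann_uv : ∀ u v, pairing (ann v) u = wedge u v := fun u v => by
    simp [ann, pairing, wedge]; ring
  have ann_vu : ∀ u v, pairing (ann u) v = - wedge u v := fun u v => by
    simp [ann, pairing, wedge]; ring
  have h00 := hF (ann (v i)) (ann (v j))
  have h01 := hF (ann (v i)) (ann (u j))
  have h10 := hF (ann (u i)) (ann (v j))
  have h11 := hF (ann (u i)) (ann (u j))
  simp only [ann_self] at h00 h01 h10 h11
  rw [ann_uv (u i), ann_uv (u j)] at h00
  rw [ann_vu _ (v i), ann_vu _ (v j)] at h11
  -- The contraction of `f` is a rank-one bilinear form in `(a, b)`, so its 2×2 determinant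
  -- vanishes. In the annihilator bases the form of the right-hand side is diagonal, with entries
  -- `α` and `β` times nonzero factors.
  have hz : (α * β) * ((wedge (u i) (v i)) ^ 2 * (wedge (u j) (v j)) ^ 2 * (R u * R v)) = 0 := by
    have e0 : α * (wedge (u j) (v j) * (wedge (u i) (v i) * R u)) *
        (β * (wedge (u j) (v j) * (wedge (u i) (v i) * R v))) =
        (pairing (ann (v j)) (f j) * (pairing (ann (v i)) (f i) * R f)) *
        (pairing (ann (u j)) (f j) * (pairing (ann (u i)) (f i) * R f)) := by
      rw [h00, h11]; ring
    have e1 : (pairing (ann (v j)) (f j) * (pairing (ann (v i)) (f i) * R f)) *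
        (pairing (ann (u j)) (f j) * (pairing (ann (u i)) (f i) * R f)) =
        (pairing (ann (u j)) (f j) * (pairing (ann (v i)) (f i) * R f)) *
        (pairing (ann (v j)) (f j) * (pairing (ann (u i)) (f i) * R f)) := by ring
    rw [h01] at e1
    rw [e1] at e0
    linear_combination e0
  refine (mul_eq_zero.1 hz).resolve_right ?_
  exact mul_ne_zero (mul_ne_zero (pow_ne_zero _ hi) (pow_ne_zero _ hj)) (mul_ne_zero hRu hRv)

/-- Some functional kills one of two product vectors that differ at some site, but not the
other. -/
theorem exists_sum_mul_productVec {u v : ι → Qubit} (hu : ∀ i, u i ≠ 0) {i : ι}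
    (hi : wedge (u i) (v i) ≠ 0) : ∃ g : (ι → Fin 2) → ℂ,
      ∑ x, g x * productVec u x ≠ 0 ∧ ∑ x, g x * productVec v x = 0 := by
  choose c hc _ using fun l => exists_pairing_ne_zero (hu l) (hu l)
  refine ⟨productVec (Function.update c i !₂[v i 1, -v i 0]), ?_, ?_⟩
  · rw [sum_productVec_mul, Finset.prod_ne_zero_iff]
    intro l _
    by_cases h : l = i
    · subst h
      refine fun h => hi ?_
      simp only [pairing, Function.update_self] at h
      simp only [wedge]
      simp at h
      linear_combination h
    · simpa [h] using hc l
  · rw [sum_productVec_mul]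
    refine Finset.prod_eq_zero (Finset.mem_univ i) ?_
    simp [pairing]
    ring

/-! ### Ensembles of pure states and their spans -/

/-- Each rank-one term factors. With `g = h` this gives a nonnegative quadratic form; with `g`, `h`
dual to two vectors it isolates an off-diagonal coefficient. -/
theorem sum_mul_sum_smul_ketBra {κ σ : Type} [Fintype κ] [Fintype σ] (w : σ → ℝ)
    (φ : σ → EuclideanSpace ℂ κ) (g h : κ → ℂ) :
    ∑ s, ∑ t, g s * (∑ a, (w a : ℂ) • ketBra (φ a)) s t * star (h t) =
      ∑ a, (w a : ℂ) * ((∑ s, g s * φ a s) * star (∑ t, h t * φ a t)) := by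
  simp only [star_sum, Finset.sum_mul_sum]
  simp only [Finset.mul_sum, Finset.sum_mul, Matrix.sum_apply, Matrix.smul_apply]
  rw [Finset.sum_comm_cycle]
  refine Finset.sum_congr rfl fun a _ => Finset.sum_congr rfl fun s _ =>
    Finset.sum_congr rfl fun t _ => ?_
  simp only [smul_eq_mul, ketBra, Matrix.of_apply, star_mul]
  ring

theorem sum_smul_ketBra_form {κ σ : Type} [Fintype κ] [Fintype σ] (w : σ → ℝ)
    (φ : σ → EuclideanSpace ℂ κ) (x : EuclideanSpace ℂ κ) :
    ∑ s, ∑ t, star (x s) * (∑ a, (w a : ℂ) • ketBra (φ a)) s t * star (star (x t)) =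
      ((∑ a, w a * ‖inner ℂ (φ a) x‖ ^ 2 : ℝ) : ℂ) := by
  rw [sum_mul_sum_smul_ketBra w φ (fun s => star (x s)) (fun s => star (x s))]
  push_cast
  refine Finset.sum_congr rfl fun a _ => ?_
  have h : ∑ s, star (x s) * φ a s = inner ℂ x (φ a) := by
    simp only [PiLp.inner_apply, RCLike.inner_apply, RCLike.star_def, mul_comm]
  rw [h, RCLike.star_def, inner_conj_symm, ← inner_conj_symm x, RCLike.conj_mul]
  rfl

/-- The vectors of a convex decomposition of `ρ` lie in the span of those of any other one. -/
theorem mem_span_of_sum_ketBra_eq {κ σ τ : Type} [Fintype κ] [Fintype σ] [Fintype τ]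
    {v : σ → ℝ} {w : τ → ℝ} {φ : σ → EuclideanSpace ℂ κ} {f : τ → EuclideanSpace ℂ κ}
    (h : ∑ a, (v a : ℂ) • ketBra (φ a) = ∑ j, (w j : ℂ) • ketBra (f j))
    (hw : ∀ j, 0 ≤ w j) {j : τ} (hj : w j ≠ 0) :
    f j ∈ Submodule.span ℂ {y | ∃ a, v a ≠ 0 ∧ y = φ a} := by
  rw [← Submodule.orthogonal_orthogonal (Submodule.span ℂ _), Submodule.mem_orthogonal]
  -- For `x` orthogonal to the first ensemble the quadratic form at `x` is zero. Computed from the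
  -- second ensemble it is a sum of nonnegative terms, so each of them vanishes.
  intro x hx
  have h1 := sum_smul_ketBra_form v φ x
  rw [h, sum_smul_ketBra_form] at h1
  have h2 : ∑ a, v a * ‖inner ℂ (φ a) x‖ ^ 2 = 0 := by
    refine Finset.sum_eq_zero fun a _ => ?_
    by_cases ha : v a = 0
    · simp [ha]
    · have := (Submodule.mem_orthogonal _ _).1 hx (φ a) (Submodule.subset_span ⟨a, ha, rfl⟩)
      simp [this]
  rw [h2] at h1
  have h3 := (Finset.sum_eq_zero_iff_of_nonneg
    (fun a _ => mul_nonneg (hw a) (sq_nonneg _))).1 (Complex.ofReal_eq_zero.1 h1) j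
    (Finset.mem_univ j)
  have h4 : inner ℂ (f j) x = 0 := by simpa [hj] using h3
  exact inner_eq_zero_symm.1 h4

/-- Schmidt decomposition of a two-qubit vector. -/
theorem exists_schmidt (T : Fin 2 → Fin 2 → ℂ) :
    ∃ A B : Fin 2 → Qubit, inner ℂ (A 0) (A 1) = 0 ∧ inner ℂ (B 0) (B 1) = 0 ∧
      (∀ s, ‖B s‖ = 1) ∧ ∀ a b, T a b = A 0 a * B 0 b + A 1 a * B 1 b := by
  let M : Matrix (Fin 2) (Fin 2) ℂ := Matrix.of T
  let L : Qubit →ₗ[ℂ] Qubit := Matrix.toEuclideanLin M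
  have hS := L.isSymmetric_adjoint_mul_self
  -- Right singular vectors: eigenvectors of `L† L`, whose images under `L` are again orthogonal.
  -- The images carry the singular values, so only `B` is normalized.
  let v := hS.eigenvectorBasis (n := 2) (by simp)
  have horth : inner ℂ (v 0) (v 1) = 0 := v.orthonormal.2 (by decide)
  refine ⟨fun s => L (v s), fun s => WithLp.toLp 2 fun b => star (v s b), ?_, ?_, ?_, ?_⟩
  · have := hS.apply_eigenvectorBasis (n := 2) (by simp) 1
    have h2 : inner ℂ (v 0) ((LinearMap.adjoint L) (L (v 1))) = 0 := by
      change inner ℂ (v 0) ((LinearMap.adjoint L * L) (v 1)) = 0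
      rw [this, inner_smul_right, horth, mul_zero]
    rwa [LinearMap.adjoint_inner_right] at h2
  · have := congrArg star horth
    simp only [PiLp.inner_apply, Fin.sum_univ_two, RCLike.inner_apply] at this ⊢
    simpa using this
  · intro s
    have := v.orthonormal.1 s
    rw [EuclideanSpace.norm_eq] at this ⊢
    simpa only [norm_star] using this
  · intro a b
    have h := v.sum_repr (EuclideanSpace.single b (1 : ℂ))
    have h2 := congrArg (fun y => L y a) h
    simp only [Fin.sum_univ_two, map_add, map_smul, v.repr_apply_apply] at h2
    have h3 : L (EuclideanSpace.single b 1) a = T a b := by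
      simp [L, Matrix.toLpLin_apply, M]
    rw [h3] at h2
    rw [← h2, EuclideanSpace.inner_single_right, EuclideanSpace.inner_single_right]
    simp only [PiLp.add_apply, PiLp.smul_apply, smul_eq_mul, one_mul, RCLike.star_def]
    ring

/-! ### Slices along a qubit and the partial trace -/

/-- The vector `⟨a|_k ψ` of the qubits other than `k`. -/
noncomputable def slice (k : ι) (ψ : Qubits ι) (a : Fin 2) : Qubits {i : ι // i ≠ k} :=
  WithLp.toLp 2 fun x => ψ (insertBit k a x)

/-- The family that is `α` at `k` and `f` elsewhere. -/
noncomputable def extendFamily (k : ι) (α : Qubit) (f : {i : ι // i ≠ k} → Qubit) (i : ι) : Qubit :=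
  if h : i = k then α else f ⟨i, h⟩

@[simp] theorem extendFamily_self (k : ι) (α : Qubit) (f : {i : ι // i ≠ k} → Qubit) :
    extendFamily k α f k = α := by simp [extendFamily]

theorem extendFamily_of_ne {k i : ι} (h : i ≠ k) (α : Qubit) (f : {i : ι // i ≠ k} → Qubit) :
    extendFamily k α f i = f ⟨i, h⟩ := by simp [extendFamily, h]

theorem insertBit_restrict (k : ι) (y : ι → Fin 2) :
    insertBit k (y k) (fun i => y i) = y := by
  funext i
  by_cases h : i = k
  · subst h; simp [insertBit]
  · simp [insertBit, h]

theorem slice_productVec (k : ι) (e : ι → Qubit) (a : Fin 2) :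
    slice k (productVec e) a = e k a • productVec fun i : {i : ι // i ≠ k} => e i := by
  ext x
  simp only [slice, productVec_apply, PiLp.smul_apply, smul_eq_mul]
  rw [Fintype.prod_eq_mul_prod_subtype_ne _ k]
  congr 1
  · simp [insertBit]
  · exact Finset.prod_congr rfl fun i _ => by simp [insertBit, i.2]

theorem slice_extendFamily (k : ι) (α : Qubit) (f : {i : ι // i ≠ k} → Qubit) (a : Fin 2) :
    slice k (productVec (extendFamily k α f)) a = α a • productVec f := by
  rw [slice_productVec, extendFamily_self]
  congr 2
  funext i
  exact extendFamily_of_ne i.2 α f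

theorem slice_add (k : ι) (ψ φ : Qubits ι) (a : Fin 2) :
    slice k (ψ + φ) a = slice k ψ a + slice k φ a := rfl

theorem slice_smul (k : ι) (c : ℂ) (ψ : Qubits ι) (a : Fin 2) :
    slice k (c • ψ) a = c • slice k ψ a := rfl

theorem ext_slice {k : ι} {ψ φ : Qubits ι} (h : ∀ a, slice k ψ a = slice k φ a) : ψ = φ := by
  ext y
  have := congrArg (fun v : Qubits {i : ι // i ≠ k} => v fun i => y i) (h (y k))
  simpa [slice, insertBit_restrict] using this

theorem partialTrace_ketBra (k : ι) (ψ : Qubits ι) :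
    partialTrace k (ketBra ψ) = ∑ a, ((1 : ℝ) : ℂ) • ketBra (slice k ψ a) := by
  ext x y
  simp [partialTrace, ketBra, slice, Matrix.add_apply]

theorem norm_ne_zero_of_norm_eq_one {u : Qubit} (h : ‖u‖ = 1) : u ≠ 0 := by
  rintro rfl; simp at h

theorem productVec_normalize {e : ι → Qubit} (he : ∀ i, e i ≠ 0) :
    productVec e = ((∏ i, ‖e i‖ : ℝ) : ℂ) • productVec fun i => ((‖e i‖⁻¹ : ℝ) : ℂ) • e i := by
  push_cast
  rw [← productVec_smul]
  congr 1
  funext i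
  have : (‖e i‖ : ℂ) ≠ 0 := by simpa using he i
  simp [smul_smul, this]

theorem norm_normalize {u : Qubit} (hu : u ≠ 0) : ‖((‖u‖⁻¹ : ℝ) : ℂ) • u‖ = 1 := by
  rw [norm_smul, Complex.norm_real, norm_inv, norm_norm,
    inv_mul_cancel₀ (norm_ne_zero_iff.2 hu)]

/-- The norms of the factors multiply to `‖ψ‖ = 1`, so normalizing every factor leaves the product
unchanged. -/
theorem IsEntangled.ne_productVec {ψ : Qubits ι} (h : IsEntangled ψ) (hψ : ‖ψ‖ = 1)
    (e : ι → Qubit) : ψ ≠ productVec e := by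
  rintro rfl
  rw [norm_productVec] at hψ
  have he : ∀ i, e i ≠ 0 := fun i hi => by
    rw [Finset.prod_eq_zero (Finset.mem_univ i) (by simp [hi])] at hψ
    exact zero_ne_one hψ
  refine h ⟨_, fun i => norm_normalize (he i), 1, by simp, ?_⟩
  conv_lhs => rw [productVec_normalize he, hψ]
  simp

/-! ### Consequences of separability of the reduced state -/

/-- If the reduced state of a superposition of two product vectors that differ at two of the
remaining qubits is separable, then the two vectors are orthogonal at the lost qubit. -/
theorem inner_eq_zero_of_isSeparable {k : ι} {ψ : Qubits ι} {α β : Qubit}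
    {u v : {i : ι // i ≠ k} → Qubit}
    (hψ : ∀ a, slice k ψ a = α a • productVec u + β a • productVec v)
    (hsep : IsSeparable (partialTrace k (ketBra ψ)))
    (hu : ∀ i, u i ≠ 0) (hv : ∀ i, v i ≠ 0) {i j : {i : ι // i ≠ k}} (hij : i ≠ j)
    (hi : wedge (u i) (v i) ≠ 0) (hj : wedge (u j) (v j) ≠ 0) : inner ℂ α β = 0 := by
  obtain ⟨m, w, e, hw, -, -, hρ⟩ := hsep
  rw [partialTrace_ketBra] at hρ
  have hmem : ∀ l, w l ≠ 0 → ∃ s t : ℂ, s * t = 0 ∧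
      productVec (e l) = s • productVec u + t • productVec v := by
    intro l hl
    have h1 := mem_span_of_sum_ketBra_eq hρ hw hl
    have h2 : Submodule.span ℂ {y | ∃ a : Fin 2, (1 : ℝ) ≠ 0 ∧ y = slice k ψ a} ≤
        Submodule.span ℂ {productVec u, productVec v} := by
      rw [Submodule.span_le]
      rintro _ ⟨a, -, rfl⟩
      rw [hψ]
      exact Submodule.mem_span_pair.2 ⟨_, _, rfl⟩
    obtain ⟨s, t, hst⟩ := Submodule.mem_span_pair.1 (h2 h1)
    exact ⟨s, t, mul_eq_zero_of_productVec_eq hst.symm hu hv hij hi hj, hst.symm⟩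
  choose! s t hst hf using hmem
  -- `g` sees only `u` and `h` only `v`, so sandwiching the reduced state between them extracts its
  -- cross term. Each separable summand contributes zero, being a multiple of `u` or of `v`.
  obtain ⟨g, hgu, hgv⟩ := exists_sum_mul_productVec (v := v) hu hi
  obtain ⟨h, hhv, hhu⟩ := exists_sum_mul_productVec (u := v) (v := u) (i := i) hv
    (fun h0 => hi (by simp only [wedge] at h0 ⊢; linear_combination -h0))
  have hlin : ∀ (g : ({i : ι // i ≠ k} → Fin 2) → ℂ) (c d : ℂ),
      ∑ x, g x * (c • productVec u + d • productVec v) x =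
        c * ∑ x, g x * productVec u x + d * ∑ x, g x * productVec v x := by
    intro g c d
    rw [Finset.mul_sum, Finset.mul_sum, ← Finset.sum_add_distrib]
    refine Finset.sum_congr rfl fun x _ => ?_
    simp only [PiLp.add_apply, PiLp.smul_apply, smul_eq_mul]
    ring
  have hform := sum_mul_sum_smul_ketBra (fun _ : Fin 2 => (1 : ℝ)) (slice k ψ) g h
  rw [hρ, sum_mul_sum_smul_ketBra] at hform
  have hleft : ∑ l, (w l : ℂ) * ((∑ x, g x * productVec (e l) x) *
      star (∑ x, h x * productVec (e l) x)) = 0 := by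
    refine Finset.sum_eq_zero fun l _ => ?_
    by_cases hl : w l = 0
    · simp [hl]
    · rw [hf l hl, hlin, hlin, hgv, hhu]
      rcases mul_eq_zero.1 (hst l hl) with h0 | h0 <;> simp [h0]
  rw [hleft] at hform
  simp only [hψ, hlin, hgv, hhu, Fin.sum_univ_two, mul_zero, add_zero, zero_add, star_mul,
    Complex.ofReal_one, one_mul] at hform
  have hz : (β 0 * star (α 0) + β 1 * star (α 1)) *
      (star (∑ x, g x * productVec u x) * ∑ x, h x * productVec v x) = 0 := by
    have := congrArg star hform
    simp only [star_zero, star_add, star_mul, star_star] at this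
    rw [this]
    ring
  have := (mul_eq_zero.1 hz).resolve_right (mul_ne_zero (star_ne_zero.2 hgu) hhv)
  simpa [PiLp.inner_apply] using this

theorem productVec_update_apply (f : ι → Qubit) (j : ι) (b : Qubit) (x : ι → Fin 2) :
    productVec (Function.update f j b) x = b (x j) * ∏ l ∈ Finset.univ.erase j, f l (x l) := by
  rw [productVec_apply, ← Finset.mul_prod_erase _ _ (Finset.mem_univ j), Function.update_self]
  congr 1
  refine Finset.prod_congr rfl fun l hl => ?_
  rw [Function.update_of_ne (Finset.ne_of_mem_erase hl)]

/-- A superposition `α ⊗ f + β ⊗ g` of two product vectors with `f`, `g` different at the single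
site `j` only. -/
theorem exists_schmidt_of_wedge_eq_zero {f g : ι → Qubit} (hf : ∀ i, ‖f i‖ = 1) (j : ι)
    (h : ∀ l, l ≠ j → wedge (f l) (g l) = 0) (α β : Qubit) :
    ∃ (u v : ι → Qubit) (a b : Qubit), (∀ i, ‖u i‖ = 1) ∧ (∀ i, ‖v i‖ = 1) ∧
      inner ℂ a b = 0 ∧ inner ℂ (u j) (v j) = 0 ∧
      ∀ s, α s • productVec f + β s • productVec g = a s • productVec u + b s • productVec v := by
  have hc : ∀ l, ∃ c : ℂ, l ≠ j → g l = c • f l := fun l => by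
    by_cases hl : l = j
    · exact ⟨0, fun h => absurd hl h⟩
    · obtain ⟨c, hc⟩ := exists_smul_of_wedge_eq_zero (norm_ne_zero_of_norm_eq_one (hf l)) (h l hl)
      exact ⟨c, fun _ => hc⟩
  choose c hc using hc
  let C : ℂ := ∏ l ∈ Finset.univ.erase j, c l
  -- Away from `j` the two products agree up to the scalar `C`, so only a vector on the lost qubit
  -- and qubit `j` remains to be decomposed.
  obtain ⟨A, B, hA, hB, hB1, hT⟩ := exists_schmidt fun s t => α s * f j t + β s * (C * g j t)
  have hupd : ∀ t i, ‖Function.update f j (B t) i‖ = 1 := fun t i => by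
    by_cases hi : i = j
    · subst hi; simpa using hB1 t
    · simpa [hi] using hf i
  refine ⟨Function.update f j (B 0), Function.update f j (B 1), A 0, A 1, hupd 0, hupd 1, hA,
    by simpa using hB, fun s => ?_⟩
  ext x
  simp only [PiLp.add_apply, PiLp.smul_apply, smul_eq_mul, productVec_update_apply]
  have hfx : productVec f x = f j (x j) * ∏ l ∈ Finset.univ.erase j, f l (x l) :=
    (Finset.mul_prod_erase _ _ (Finset.mem_univ j)).symm
  have hgx : productVec g x = g j (x j) * (C * ∏ l ∈ Finset.univ.erase j, f l (x l)) := by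
    rw [productVec_apply, ← Finset.mul_prod_erase _ _ (Finset.mem_univ j),
      ← Finset.prod_mul_distrib]
    congr 1
    refine Finset.prod_congr rfl fun l hl => ?_
    rw [hc l (Finset.ne_of_mem_erase hl)]
    rfl
  rw [hfx, hgx]
  linear_combination (∏ l ∈ Finset.univ.erase j, f l (x l)) * hT s (x j)

/-- The reduced state of an entangled state has two independent product vectors in its range, and
these span the range. -/
theorem exists_slice_eq {k : ι} {ψ : Qubits ι} (hent : IsEntangled ψ) (hψ : ‖ψ‖ = 1)
    (hsep : IsSeparable (partialTrace k (ketBra ψ))) :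
    ∃ (f g : {i : ι // i ≠ k} → Qubit) (α β : Qubit), (∀ i, ‖f i‖ = 1) ∧ (∀ i, ‖g i‖ = 1) ∧
      (∃ j, wedge (f j) (g j) ≠ 0) ∧
      ∀ a, slice k ψ a = α a • productVec f + β a • productVec g := by
  obtain ⟨m, w, e, hw, hw1, he, hρ⟩ := hsep
  rw [partialTrace_ketBra] at hρ
  have hrev : ∀ a, slice k ψ a ∈ Submodule.span ℂ {y | ∃ l, w l ≠ 0 ∧ y = productVec (e l)} :=
    fun a => mem_span_of_sum_ketBra_eq (j := a) hρ.symm (fun _ => zero_le_one) one_ne_zero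
  have hfwd : ∀ l, w l ≠ 0 → productVec (e l) ∈ Submodule.span ℂ (Set.range (slice k ψ)) := by
    intro l hl
    refine Submodule.span_mono ?_ (mem_span_of_sum_ketBra_eq hρ hw hl)
    rintro _ ⟨a, -, rfl⟩
    exact ⟨a, rfl⟩
  obtain ⟨p, hp⟩ : ∃ p, w p ≠ 0 := by
    by_contra! h
    simp [h] at hw1
  have hne : ∀ l, productVec (e l) ≠ 0 := fun l => by
    rw [← norm_ne_zero_iff, norm_productVec]
    simp [he]
  by_cases hpar : ∀ l, w l ≠ 0 → ∃ c : ℂ, c • productVec (e p) = productVec (e l)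
  · exfalso
    have hle : Submodule.span ℂ {y | ∃ l, w l ≠ 0 ∧ y = productVec (e l)} ≤
        Submodule.span ℂ {productVec (e p)} := by
      rw [Submodule.span_le]
      rintro _ ⟨l, hl, rfl⟩
      exact Submodule.mem_span_singleton.2 (hpar l hl)
    choose c hc using fun a => Submodule.mem_span_singleton.1 (hle (hrev a))
    refine hent.ne_productVec hψ (extendFamily k (WithLp.toLp 2 c) (e p))
      (ext_slice (k := k) fun a => ?_)
    rw [slice_extendFamily, ← hc]
  push Not at hpar
  obtain ⟨q, hq, hpq⟩ := hpar
  have hind : LinearIndependent ℂ ![productVec (e p), productVec (e q)] :=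
    (LinearIndependent.pair_iff' (hne p)).2 hpq
  -- The two slices span at most two dimensions, so two independent product vectors in that span
  -- fill it.
  have hspan : Submodule.span ℂ (Set.range ![productVec (e p), productVec (e q)]) =
      Submodule.span ℂ (Set.range (slice k ψ)) := by
    refine Submodule.eq_of_le_of_finrank_le ?_ ?_
    · rw [Submodule.span_le]
      rintro _ ⟨i, rfl⟩
      fin_cases i
      · exact hfwd p hp
      · exact hfwd q hq
    · rw [finrank_span_eq_card hind]
      exact finrank_range_le_card _
  have hmem : ∀ a, slice k ψ a ∈ Submodule.span ℂ {productVec (e p), productVec (e q)} := by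
    intro a
    rw [← Matrix.range_cons_cons_empty, hspan]
    exact Submodule.subset_span ⟨a, rfl⟩
  choose α β hαβ using fun a => Submodule.mem_span_pair.1 (hmem a)
  refine ⟨e p, e q, WithLp.toLp 2 α, WithLp.toLp 2 β, he p, he q, ?_, fun a => (hαβ a).symm⟩
  by_contra! h
  choose c hc using fun j =>
    exists_smul_of_wedge_eq_zero (norm_ne_zero_of_norm_eq_one (he p j)) (h j)
  refine hpq (∏ j, c j) ?_
  rw [← productVec_smul]
  exact congrArg productVec (funext fun j => (hc j).symm)

/-- The disjunction for each `l` is what the loss of a second qubit `l` requires: orthogonality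
there, or a differing site that survives. It holds when `f`, `g` differ at two sites, and otherwise
because the Schmidt vectors are orthogonal at the single differing site. -/
theorem exists_orthogonal_slice_eq {k : ι} {ψ : Qubits ι} (hent : IsEntangled ψ) (hψ : ‖ψ‖ = 1)
    (hsep : IsSeparable (partialTrace k (ketBra ψ))) :
    ∃ (u v : {i : ι // i ≠ k} → Qubit) (α β : Qubit), (∀ i, ‖u i‖ = 1) ∧ (∀ i, ‖v i‖ = 1) ∧
      inner ℂ α β = 0 ∧ (∀ l, inner ℂ (u l) (v l) = 0 ∨ ∃ j, j ≠ l ∧ wedge (u j) (v j) ≠ 0) ∧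
      ∀ a, slice k ψ a = α a • productVec u + β a • productVec v := by
  obtain ⟨f, g, α, β, hf, hg, ⟨j, hj⟩, hs⟩ := exists_slice_eq hent hψ hsep
  by_cases h : ∃ i, i ≠ j ∧ wedge (f i) (g i) ≠ 0
  · obtain ⟨i, hij, hi⟩ := h
    refine ⟨f, g, α, β, hf, hg, inner_eq_zero_of_isSeparable hs hsep
      (fun i => norm_ne_zero_of_norm_eq_one (hf i)) (fun i => norm_ne_zero_of_norm_eq_one (hg i))
      hij hi hj, fun l => Or.inr ?_, hs⟩
    by_cases hl : j = l
    · exact ⟨i, hl ▸ hij, hi⟩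
    · exact ⟨j, hl, hj⟩
  · push Not at h
    obtain ⟨u, v, a, b, hu, hv, hab, huv, hs'⟩ := exists_schmidt_of_wedge_eq_zero hf j h α β
    refine ⟨u, v, a, b, hu, hv, hab, fun l => ?_, fun s => (hs s).trans (hs' s)⟩
    by_cases hl : j = l
    · exact Or.inl (hl ▸ huv)
    · exact Or.inr ⟨j, hl, wedge_ne_zero_of_inner_eq_zero (norm_ne_zero_of_norm_eq_one (hu j))
        (norm_ne_zero_of_norm_eq_one (hv j)) huv⟩

/-! ### Normal form for the loss of one qubit -/

/-- Normal form of an entangled state that is fragile with respect to the loss of qubit `k`. -/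
theorem exists_normal_form {k : ι} {ψ : Qubits ι} (hψ : ‖ψ‖ = 1) (hfrag : IsFragile k ψ) :
    ∃ (p : ℝ) (e e' : ι → Qubit), 0 < p ∧ p < 1 ∧ (∀ i, ‖e i‖ = 1) ∧ (∀ i, ‖e' i‖ = 1) ∧
      ψ = ((Real.sqrt p : ℝ) : ℂ) • productVec e + ((Real.sqrt (1 - p) : ℝ) : ℂ) • productVec e' ∧
      inner ℂ (e k) (e' k) = 0 ∧
      ∀ l, l ≠ k → inner ℂ (e l) (e' l) = 0 ∨
        ∃ j, j ≠ k ∧ j ≠ l ∧ wedge (e j) (e' j) ≠ 0 := by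
  obtain ⟨hent, hsep⟩ := hfrag
  obtain ⟨u, v, α, β, hu, hv, hαβ, huv, hs⟩ := exists_orthogonal_slice_eq hent hψ hsep
  have hsum : ψ = productVec (extendFamily k α u) + productVec (extendFamily k β v) :=
    ext_slice fun a => by rw [slice_add, slice_extendFamily, slice_extendFamily, hs]
  have hnorm : ∀ (γ : Qubit) (f : {i : ι // i ≠ k} → Qubit), (∀ i, ‖f i‖ = 1) →
      ‖productVec (extendFamily k γ f)‖ = ‖γ‖ := by
    intro γ f hf
    rw [norm_productVec, Fintype.prod_eq_mul_prod_subtype_ne _ k, extendFamily_self,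
      Finset.prod_eq_one, mul_one]
    intro i _
    rw [extendFamily_of_ne i.2, hf]
  have hzero : ∀ f : {i : ι // i ≠ k} → Qubit, productVec (extendFamily k 0 f) = 0 := fun f =>
    ext_slice fun a => by
      rw [slice_extendFamily]
      simp [slice]
      rfl
  have hα : α ≠ 0 := by
    rintro rfl
    rw [hzero, zero_add] at hsum
    exact hent.ne_productVec hψ _ hsum
  have hβ : β ≠ 0 := by
    rintro rfl
    rw [hzero, add_zero] at hsum
    exact hent.ne_productVec hψ _ hsum
  have hpyth : ‖α‖ ^ 2 + ‖β‖ ^ 2 = 1 := by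
    have horth : inner ℂ (productVec (extendFamily k α u)) (productVec (extendFamily k β v)) =
        0 := by
      rw [inner_productVec]
      exact Finset.prod_eq_zero (Finset.mem_univ k) (by simpa using hαβ)
    have := norm_add_sq_eq_norm_sq_add_norm_sq_of_inner_eq_zero _ _ horth
    rw [← hsum, hψ, hnorm α u hu, hnorm β v hv] at this
    linarith
  have hα0 : 0 < ‖α‖ := norm_pos_iff.2 hα
  have hβ0 : 0 < ‖β‖ := norm_pos_iff.2 hβ
  have hscale : ∀ (γ : Qubit), γ ≠ 0 → ∀ f : {i : ι // i ≠ k} → Qubit,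
      productVec (extendFamily k γ f) =
        (‖γ‖ : ℂ) • productVec (extendFamily k (((‖γ‖⁻¹ : ℝ) : ℂ) • γ) f) := by
    intro γ hγ f
    refine ext_slice (k := k) fun a => ?_
    have : (‖γ‖ : ℂ) ≠ 0 := by simpa using hγ
    rw [slice_smul, slice_extendFamily, slice_extendFamily, smul_smul]
    simp [this]
  have hunit : ∀ (γ : Qubit), γ ≠ 0 → ∀ f : {i : ι // i ≠ k} → Qubit, (∀ i, ‖f i‖ = 1) →
      ∀ i, ‖extendFamily k (((‖γ‖⁻¹ : ℝ) : ℂ) • γ) f i‖ = 1 := by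
    intro γ hγ f hf i
    by_cases hi : i = k
    · subst hi
      rw [extendFamily_self, norm_normalize hγ]
    · rw [extendFamily_of_ne hi, hf]
  -- All other factors are unit vectors, so the weights are the squared norms of `α` and `β`, which
  -- add up to 1 by Pythagoras.
  refine ⟨‖α‖ ^ 2, extendFamily k (((‖α‖⁻¹ : ℝ) : ℂ) • α) u,
    extendFamily k (((‖β‖⁻¹ : ℝ) : ℂ) • β) v, by positivity, by nlinarith, hunit α hα u hu,
    hunit β hβ v hv, ?_, ?_, ?_⟩
  · rw [show 1 - ‖α‖ ^ 2 = ‖β‖ ^ 2 by linarith, Real.sqrt_sq hα0.le, Real.sqrt_sq hβ0.le,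
      ← hscale α hα, ← hscale β hβ, hsum]
  · rw [extendFamily_self, extendFamily_self, inner_smul_left, inner_smul_right, hαβ, mul_zero,
      mul_zero]
  · intro l hl
    rcases huv ⟨l, hl⟩ with h | ⟨j, hj, hw⟩
    · left
      rwa [extendFamily_of_ne hl, extendFamily_of_ne hl]
    · refine Or.inr ⟨j, j.2, fun h => hj (Subtype.ext h), ?_⟩
      rwa [extendFamily_of_ne j.2, extendFamily_of_ne j.2]

/-! ### Entanglement and fragility of the superposition -/

theorem slice_superposition (k : ι) (c d : ℂ) (e e' : ι → Qubit) (a : Fin 2) :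
    slice k (c • productVec e + d • productVec e') a =
      (c • e k) a • productVec (fun i : {i : ι // i ≠ k} => e i) +
        (d • e' k) a • productVec (fun i : {i : ι // i ≠ k} => e' i) := by
  rw [slice_add, slice_smul, slice_smul, slice_productVec, slice_productVec, smul_smul, smul_smul]
  rfl

theorem isEntangled_superposition {ψ : Qubits ι} {c d : ℂ} {e e' : ι → Qubit} (hc : c ≠ 0)
    (hd : d ≠ 0) (he : ∀ i, e i ≠ 0) (he' : ∀ i, e' i ≠ 0)
    (hψ : SameState ψ (c • productVec e + d • productVec e')) {i j : ι} (hij : i ≠ j)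
    (hi : wedge (e i) (e' i) ≠ 0) (hj : wedge (e j) (e' j) ≠ 0) : IsEntangled ψ := by
  rintro ⟨f, -, z, hz, hf⟩
  obtain ⟨y, hy, hψy⟩ := hψ
  have hz0 : z ≠ 0 := by rintro rfl; simp at hz
  have hy0 : y ≠ 0 := by rintro rfl; simp at hy
  have h : productVec f = (z⁻¹ * (y * c)) • productVec e + (z⁻¹ * (y * d)) • productVec e' := by
    rw [← inv_smul_smul₀ hz0 (productVec f), ← hf, hψy]
    simp only [smul_add, smul_smul]
  have := mul_eq_zero_of_productVec_eq h he he' hij hi hj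
  simp [hz0, hy0, hc, hd] at this

/-- The cross terms of the reduced state carry the coefficient `⟨α, β⟩` or its conjugate; what
remains is a mixture of `u` and `v` with weights `‖α‖ ^ 2` and `‖β‖ ^ 2`. -/
theorem isSeparable_partialTrace_of_slice_eq {k : ι} {ψ : Qubits ι} {α β : Qubit}
    {u v : {i : ι // i ≠ k} → Qubit}
    (hψ : ∀ a, slice k ψ a = α a • productVec u + β a • productVec v)
    (hu : ∀ i, ‖u i‖ = 1) (hv : ∀ i, ‖v i‖ = 1) (hαβ : inner ℂ α β = 0)
    (hnorm : ‖α‖ ^ 2 + ‖β‖ ^ 2 = 1) : IsSeparable (partialTrace k (ketBra ψ)) := by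
  refine ⟨2, ![‖α‖ ^ 2, ‖β‖ ^ 2], ![u, v], fun j => ?_, by simpa using hnorm, fun j => ?_, ?_⟩
  · fin_cases j <;> simp
  · fin_cases j
    · exact hu
    · exact hv
  · have hsq : ∀ γ : Qubit, ((‖γ‖ ^ 2 : ℝ) : ℂ) = γ 0 * star (γ 0) + γ 1 * star (γ 1) := by
      intro γ
      have := inner_self_eq_norm_sq_to_K (𝕜 := ℂ) γ
      simp only [PiLp.inner_apply, Fin.sum_univ_two, RCLike.inner_apply] at this
      push_cast
      exact this.symm
    have h1 : β 0 * star (α 0) + β 1 * star (α 1) = 0 := by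
      simpa [PiLp.inner_apply] using hαβ
    have h2 : α 0 * star (β 0) + α 1 * star (β 1) = 0 := by
      have := congrArg star h1
      simp only [star_add, star_mul, star_star, star_zero] at this
      exact this
    rw [partialTrace_ketBra]
    ext x y
    simp only [Fin.sum_univ_two, Matrix.add_apply, Matrix.smul_apply, ketBra, Matrix.of_apply, hψ,
      PiLp.add_apply, PiLp.smul_apply, smul_eq_mul, star_add, star_mul, Matrix.cons_val_zero,
      Matrix.cons_val_one, hsq, Complex.ofReal_one, one_mul]
    linear_combination (productVec v x * star (productVec u y)) * h1 +
      (productVec u x * star (productVec v y)) * h2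

end QubitFragility

open QubitFragility

/-! ### The characterization -/

theorem theorem1 (N : ℕ) (hN : 3 ≤ N) (A : Finset (Fin N)) (hA : A.Nonempty)
    (ψ : QubitFragility.Qubits (Fin N)) (hψ : ‖ψ‖ = 1) :
    (QubitFragility.IsEntangled ψ ∧ ∀ k ∈ A, QubitFragility.IsFragile k ψ) ↔
      ∃ (p : ℝ) (e e' : Fin N → QubitFragility.Qubit),
        0 < p ∧ p < 1 ∧
        (∀ i, ‖e i‖ = 1) ∧ (∀ i, ‖e' i‖ = 1) ∧
        QubitFragility.SameState ψ
          (((Real.sqrt p : ℝ) : ℂ) • QubitFragility.productVec e +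
            ((Real.sqrt (1 - p) : ℝ) : ℂ) • QubitFragility.productVec e') ∧
        (∀ i ∈ A, inner ℂ (e i) (e' i) = 0) ∧
        (A.card = 1 → ∃ j, j ∉ A ∧ ¬ QubitFragility.SameState (e' j) (e j)) := by
  constructor
  · rintro ⟨hent, hfrag⟩
    obtain ⟨k, hk⟩ := hA
    obtain ⟨p, e, e', hp0, hp1, he, he', hsum, hek, hel⟩ := exists_normal_form hψ (hfrag k hk)
    have he0 := fun i => norm_ne_zero_of_norm_eq_one (he i)
    have he0' := fun i => norm_ne_zero_of_norm_eq_one (he' i)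
    have hsp : ((Real.sqrt p : ℝ) : ℂ) ≠ 0 :=
      Complex.ofReal_ne_zero.2 (Real.sqrt_pos.2 hp0).ne'
    have hsq : ((Real.sqrt (1 - p) : ℝ) : ℂ) ≠ 0 :=
      Complex.ofReal_ne_zero.2 (Real.sqrt_pos.2 (sub_pos.2 hp1)).ne'
    refine ⟨p, e, e', hp0, hp1, he, he', ⟨1, by simp, by rw [one_smul, hsum]⟩, fun l hl => ?_,
      fun hcard => ?_⟩
    · by_cases hlk : l = k
      · rw [hlk, hek]
      rcases hel l hlk with h | ⟨j, hjk, hjl, hj⟩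
      · exact h
      have hs := slice_superposition l ((Real.sqrt p : ℝ) : ℂ) ((Real.sqrt (1 - p) : ℝ) : ℂ) e e'
      rw [← hsum] at hs
      -- With `l` lost, the two terms still differ at `j` and, by orthogonality, at `k`.
      have h := inner_eq_zero_of_isSeparable hs (hfrag l hl).2 (fun i => he0 i) (fun i => he0' i)
        (i := ⟨j, hjl⟩) (j := ⟨k, Ne.symm hlk⟩) (fun h => hjk (congrArg Subtype.val h)) hj
        (wedge_ne_zero_of_inner_eq_zero (he0 k) (he0' k) hek)
      rw [inner_smul_left, inner_smul_right] at h
      exact ((mul_eq_zero.1 ((mul_eq_zero.1 h).resolve_left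
        ((map_ne_zero _).2 hsp))).resolve_left hsq)
    · obtain ⟨k', rfl⟩ := Finset.card_eq_one.1 hcard
      obtain rfl := Finset.mem_singleton.1 hk
      by_contra! hall
      have hsmul : ∀ i, ∃ c : ℂ, i ≠ k → e' i = c • e i := fun i => by
        by_cases hi : i = k
        · exact ⟨0, fun h => absurd hi h⟩
        · obtain ⟨c, -, hc⟩ := hall i (by simpa using hi)
          exact ⟨c, fun _ => hc⟩
      choose c hc using hsmul
      have hrest : productVec (fun i : {i // i ≠ k} => e' i) =
          (∏ i : {i // i ≠ k}, c i) • productVec (fun i : {i // i ≠ k} => e i) := by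
        rw [← productVec_smul]
        exact congrArg productVec (funext fun i => hc i i.2)
      -- If the terms agreed up to phase away from `k`, they would merge into one product with the
      -- combined vector at `k`.
      refine hent.ne_productVec hψ (extendFamily k (((Real.sqrt p : ℝ) : ℂ) • e k +
        ((∏ i : {i // i ≠ k}, c i) * ((Real.sqrt (1 - p) : ℝ) : ℂ)) • e' k) fun i => e i)
        (ext_slice (k := k) fun a => ?_)
      rw [slice_extendFamily, hsum, slice_superposition, hrest, smul_smul, ← add_smul]
      congr 1
      simp only [PiLp.add_apply, PiLp.smul_apply, smul_eq_mul]
      ring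
  · rintro ⟨p, e, e', hp0, hp1, he, he', hst, horth, hcard⟩
    have he0 := fun i => norm_ne_zero_of_norm_eq_one (he i)
    have he0' := fun i => norm_ne_zero_of_norm_eq_one (he' i)
    have hsp : ((Real.sqrt p : ℝ) : ℂ) ≠ 0 :=
      Complex.ofReal_ne_zero.2 (Real.sqrt_pos.2 hp0).ne'
    have hsq : ((Real.sqrt (1 - p) : ℝ) : ℂ) ≠ 0 :=
      Complex.ofReal_ne_zero.2 (Real.sqrt_pos.2 (sub_pos.2 hp1)).ne'
    have hw : ∀ i ∈ A, wedge (e i) (e' i) ≠ 0 := fun i hi =>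
      wedge_ne_zero_of_inner_eq_zero (he0 i) (he0' i) (horth i hi)
    have hent : IsEntangled ψ := by
      -- The second differing site comes from the extra condition when `A` is a singleton, and from
      -- `A` itself otherwise.
      by_cases h1 : A.card = 1
      · obtain ⟨k, hk⟩ := hA
        obtain ⟨j, hjA, hj⟩ := hcard h1
        exact isEntangled_superposition hsp hsq he0 he0' hst
          (ne_of_mem_of_not_mem hk hjA) (hw k hk)
          (wedge_ne_zero_of_not_sameState (he j) (he' j) hj)
      · obtain ⟨i, hi, j, hj, hij⟩ := Finset.one_lt_card.1
          (lt_of_le_of_ne hA.card_pos (Ne.symm h1))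
        exact isEntangled_superposition hsp hsq he0 he0' hst hij (hw i hi) (hw j hj)
    refine ⟨hent, fun k hk => ⟨hent, ?_⟩⟩
    obtain ⟨z, hz, hψz⟩ := hst
    have hs := slice_superposition k (z * ((Real.sqrt p : ℝ) : ℂ))
      (z * ((Real.sqrt (1 - p) : ℝ) : ℂ)) e e'
    rw [← smul_smul, ← smul_smul, ← smul_add, ← hψz] at hs
    refine isSeparable_partialTrace_of_slice_eq hs (fun i => he i) (fun i => he' i) ?_ ?_
    · rw [inner_smul_left, inner_smul_right, horth k hk, mul_zero, mul_zero]
    · rw [norm_smul, norm_smul, he, he', norm_mul, norm_mul, hz, Complex.norm_real,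
        Complex.norm_real, one_mul, one_mul, mul_one, mul_one, Real.norm_eq_abs, Real.norm_eq_abs,
        sq_abs, sq_abs, Real.sq_sqrt hp0.le, Real.sq_sqrt (sub_pos.2 hp1).le]
      ring
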